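/- Call a (multiple) sequence of rationals recursive if it has the form $(-1)^{s}p/q$ with total recursive functions $s,p,q$ of its indices and $q\neq 0$. A (multiple) sequence of reals $\{x_i\}$ is computable if there is a recursive sequence of rationals $\{r_{i,k}\}$ with $|r_{i,k}-x_i|\le 2^{-k}$ for all $i,k$; a sequence of complex numbers $\{z_i\}$ is computable if there are recursive sequences of rationals $\{r_{i,k}\},\{s_{i,k}\}$ with $|r_{i,k}+\sqrt{-1}\,s_{i,k}-z_i|\le 2^{-k}$ for all $i,k$. A sequence of functions $f_n:\mathbb R\to\mathbb R$ is computable if (i) $\{f_n(x_j)\}_{n,j}$ is a computable double sequence for every computable sequence of reals $\{x_j\}$, and (ii) there is a recursive function $\alpha(n,L,k)$ such that $|x|,|y|\le L$ and $|x-y|<2^{-\alpha(n,L,k)}$ imply $|f_n(x)-f_n(y)|<2^{-k}$. It is computable with compact support if, in addition, there is a recursive function $L(n)$ with $f_n(x)=0$ whenever $|x|\ge L(n)$. A sequence $\{\mu_m\}$ of probability distributions (Borel probability measures on $\mathbb R$) is computable if $\{\int f_n\,d\mu_m\}_{m,n}$ is a computable double sequence of reals for every sequence $\{f_n\}$ that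 is computable with compact support. **Theorem 4.1.** If a sequence of probability distributions $\{\mu_m\}$ is computable, then the corresponding sequence of characteristic functions $\varphi_m(t)=\int_{\mathbb R}e^{itx}\,\mu_m(dx)$ is uniformly computable, that is: 1. $\{\varphi_m(t_n)\}_{m,n}$ is a computable double sequence of complex numbers for every computable sequence of reals $\{t_n\}$; and 2. there is a recursive function $\alpha(m,k)$ such that, for all $m,k$ and all $t,u\in\mathbb R$, $|t-u|<2^{-\alpha(m,k)}$ implies $|\varphi_m(t)-\varphi_m(u)|<2^{-k}$. -/

import Mathlib

open MeasureTheory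

namespace CompProb

/-- A (multiple) sequence of rationals is recursive if it is `(-1)^s * p / q` for recursive
`s`, `p`, `q` with `q` never zero. The index type `ι` is `ℕ`, `ℕ × ℕ`, and so on. -/
def RecursiveRat {ι : Type} [Primcodable ι] (r : ι → ℚ) : Prop :=
  ∃ s p q : ι → ℕ, Computable s ∧ Computable p ∧ Computable q ∧
    ∀ i, q i ≠ 0 ∧ r i = (-1) ^ s i * (p i : ℚ) / (q i : ℚ)

/-- A (multiple) sequence of reals is computable if it is effectively approximated by a
recursive sequence of rationals with one more index. -/
def ComputableRealSeq {ι : Type} [Primcodable ι] (x : ι → ℝ) : Prop :=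
  ∃ r : ι × ℕ → ℚ, RecursiveRat r ∧ ∀ i k, |(r (i, k) : ℝ) - x i| ≤ (1 / 2 : ℝ) ^ k

/-- A (multiple) sequence of complex numbers is computable if it is effectively approximated by
a recursive sequence `r + i s` of rational complex numbers. -/
def ComputableComplexSeq {ι : Type} [Primcodable ι] (z : ι → ℂ) : Prop :=
  ∃ r s : ι × ℕ → ℚ, RecursiveRat r ∧ RecursiveRat s ∧
    ∀ i k, ‖((r (i, k) : ℂ) + (s (i, k) : ℂ) * Complex.I) - z i‖ ≤ (1 / 2 : ℝ) ^ k

/-- A sequence of real functions on `ℝ` is computable: sequential computability together with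
effective continuity (a recursive modulus of continuity on each `[-L, L]`). -/
structure ComputableFunSeq (f : ℕ → ℝ → ℝ) : Prop where
  sequential : ∀ x : ℕ → ℝ, ComputableRealSeq x →
    ComputableRealSeq fun i : ℕ × ℕ => f i.1 (x i.2)
  effectivelyContinuous : ∃ α : ℕ × ℕ × ℕ → ℕ, Computable α ∧
    ∀ (n L k : ℕ) (x y : ℝ), |x| ≤ L → |y| ≤ L → |x - y| < (1 / 2 : ℝ) ^ α (n, L, k) →
      |f n x - f n y| < (1 / 2 : ℝ) ^ k

/-- A computable sequence of functions with compact support: moreover `f n` vanishes where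
`|x| ≥ L n`, for a recursive `L`. -/
def ComputableCompactSupport (f : ℕ → ℝ → ℝ) : Prop :=
  ComputableFunSeq f ∧
    ∃ L : ℕ → ℕ, Computable L ∧ ∀ (n : ℕ) (x : ℝ), (L n : ℝ) ≤ |x| → f n x = 0

/-- A sequence of probability distributions is computable if `∫ f n ∂(μ m)` is a computable
double sequence of reals for every computable sequence `f` with compact support. -/
def ComputableDistSeq (μ : ℕ → Measure ℝ) : Prop :=
  ∀ f : ℕ → ℝ → ℝ, ComputableCompactSupport f →
    ComputableRealSeq fun i : ℕ × ℕ => ∫ x, f i.2 x ∂(μ i.1)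

/-- A sequence of complex-valued functions on `ℝ` is uniformly computable: sequential
computability together with effective uniform continuity, that is, a recursive modulus of
continuity valid on all of `ℝ`. -/
structure UniformlyComputableFunSeq (φ : ℕ → ℝ → ℂ) : Prop where
  sequential : ∀ t : ℕ → ℝ, ComputableRealSeq t →
    ComputableComplexSeq fun i : ℕ × ℕ => φ i.1 (t i.2)
  effectivelyUniformlyContinuous : ∃ α : ℕ × ℕ → ℕ, Computable α ∧
    ∀ (m k : ℕ) (t u : ℝ), |t - u| < (1 / 2 : ℝ) ^ α (m, k) →
      ‖φ m t - φ m u‖ < (1 / 2 : ℝ) ^ k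

end CompProb

/-!
The characteristic function at `t` integrates the bounded computable functions `cos (t x)` and
`sin (t x)`, whereas computability of the measures `μ_m` speaks only of compactly supported test
functions. The bridge is effective tightness. For the tent `w_N` of height `1` supported on
`[-(N + 1), N + 1]`, the numbers `∫ w_N ∂μ_m` form a computable double sequence increasing to the
total mass, and strict inequality between computable reals is semidecidable, so a search finds,
recursively in `m` and `k`, an `N` leaving mass less than `2⁻ᵏ` outside `w_N`. Hence the integrals
of a bounded computable `f` are effective limits of the integrals of `w_N f`; this applies to
`cos (t_n x)` and `sin (t_n x)`. For the modulus of continuity, `|e^{itx} - e^{iux}|` is at most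
`(N + 1) |t - u|` on the support of `w_N` and at most `2` outside it.
-/

namespace CompProb

section Computable

variable {ι : Type} [Primcodable ι] {f g : ι → ℕ}

theorem computable_add (hf : Computable f) (hg : Computable g) : Computable fun i => f i + g i :=
  Primrec.nat_add.to_comp.comp hf hg

theorem computable_sub (hf : Computable f) (hg : Computable g) : Computable fun i => f i - g i :=
  Primrec.nat_sub.to_comp.comp hf hg

theorem computable_mul (hf : Computable f) (hg : Computable g) : Computable fun i => f i * g i :=
  Primrec.nat_mul.to_comp.comp hf hg

theorem computable_div (hf : Computable f) (hg : Computable g) : Computable fun i => f i / g i :=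
  Primrec.nat_div.to_comp.comp hf hg

theorem computable_mod (hf : Computable f) (hg : Computable g) : Computable fun i => f i % g i :=
  Primrec.nat_mod.to_comp.comp hf hg

theorem computable_pow (hf : Computable f) (hg : Computable g) : Computable fun i => f i ^ g i :=
  (Primrec₂.unpaired'.1 Nat.Primrec.pow).to_comp.comp hf hg

theorem computable_natPair (hf : Computable f) (hg : Computable g) :
    Computable fun i => Nat.pair (f i) (g i) :=
  Primrec₂.natPair.to_comp.comp hf hg

theorem computable_unpair_fst (hf : Computable f) : Computable fun i => (f i).unpair.1 :=
  Computable.fst.comp (Computable.unpair.comp hf)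

theorem computable_unpair_snd (hf : Computable f) : Computable fun i => (f i).unpair.2 :=
  Computable.snd.comp (Computable.unpair.comp hf)

theorem computablePred_lt (hf : Computable f) (hg : Computable g) :
    ComputablePred fun i => f i < g i :=
  (Primrec.nat_lt.decide.to_comp.comp hf hg).computablePred

theorem computable_ite {p : ι → Prop} [DecidablePred p] (hp : ComputablePred p)
    (hf : Computable f) (hg : Computable g) : Computable fun i => if p i then f i else g i :=
  (Computable.cond hp.decide hf hg).of_eq fun _ => Bool.cond_decide ..

@[to_additive]
theorem computable_prod_range {M : Type} [CommMonoid M] [Primcodable M]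
    (hmul : Computable₂ fun a b : M => a * b) {u : ι × ℕ → M} (hu : Computable u)
    (hf : Computable f) : Computable fun i => ∏ j ∈ Finset.range (f i), u (i, j) := by
  have hstep : Computable₂ fun (i : ι) (s : ℕ × M) => s.2 * u (i, s.1) :=
    hmul.comp (Computable.snd.comp .snd)
      (hu.comp (Computable.fst.pair (Computable.fst.comp .snd)))
  refine (Computable.nat_rec hf (Computable.const 1) hstep).of_eq fun i => ?_
  induction f i with
  | zero => rfl
  | succ n ih => rw [Finset.prod_range_succ, ← ih]

theorem computable_factorial (hf : Computable f) : Computable fun i => (f i).factorial :=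
  (computable_prod_range Primrec.nat_mul.to_comp (Computable.succ.comp .snd) hf).of_eq
    fun i => Finset.prod_range_add_one_eq_factorial (f i)

theorem exists_computable_of_computablePred {p : ι × ℕ → Prop} (hp : ComputablePred p)
    (h : ∀ i, ∃ n, p (i, n)) : ∃ N : ι → ℕ, Computable N ∧ ∀ i, p (i, N i) := by
  classical
  exact ⟨_, Computable.find (P := fun i n => p (i, n)) hp h, fun i => Nat.find_spec (h i)⟩

end Computable

namespace RecursiveRat

variable {ι κ : Type} [Primcodable ι] [Primcodable κ] {r r' : ι → ℚ}

theorem comp (hr : RecursiveRat r) {e : κ → ι} (he : Computable e) :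
    RecursiveRat fun j => r (e j) := by
  obtain ⟨s, p, q, hs, hp, hq, h⟩ := hr
  exact ⟨_, _, _, hs.comp he, hp.comp he, hq.comp he, fun j => h (e j)⟩

theorem natCast {f : ι → ℕ} (hf : Computable f) : RecursiveRat fun i => (f i : ℚ) :=
  ⟨fun _ => 0, f, fun _ => 1, .const _, hf, .const _, fun i => by simp⟩

theorem inv_natCast {f : ι → ℕ} (hf : Computable f) (h : ∀ i, f i ≠ 0) :
    RecursiveRat fun i => (f i : ℚ)⁻¹ :=
  ⟨fun _ => 0, fun _ => 1, f, .const _, .const _, hf, fun i => by simp [h i]⟩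

theorem mul (hr : RecursiveRat r) (hr' : RecursiveRat r') : RecursiveRat fun i => r i * r' i := by
  obtain ⟨s, p, q, hs, hp, hq, h⟩ := hr
  obtain ⟨s', p', q', hs', hp', hq', h'⟩ := hr'
  refine ⟨_, _, _, computable_add hs hs', computable_mul hp hp', computable_mul hq hq',
    fun i => ⟨mul_ne_zero (h i).1 (h' i).1, ?_⟩⟩
  simp only [(h i).2, (h' i).2]
  push_cast
  ring

theorem pow (hr : RecursiveRat r) {e : ι → ℕ} (he : Computable e) :
    RecursiveRat fun i => r i ^ e i := by
  obtain ⟨s, p, q, hs, hp, hq, h⟩ := hr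
  refine ⟨_, _, _, computable_mul hs he, computable_pow hp he, computable_pow hq he,
    fun i => ⟨pow_ne_zero _ (h i).1, ?_⟩⟩
  simp only [(h i).2]
  push_cast
  rw [div_pow, mul_pow, pow_mul]

theorem half_pow {e : ι → ℕ} (he : Computable e) : RecursiveRat fun i => (1 / 2 : ℚ) ^ e i := by
  simpa using (inv_natCast (.const 2) fun _ => two_ne_zero).pow he

theorem abs (hr : RecursiveRat r) : RecursiveRat fun i => |r i| := by
  obtain ⟨_, p, q, -, hp, hq, h⟩ := hr
  refine ⟨fun _ => 0, p, q, .const _, hp, hq, fun i => ⟨(h i).1, ?_⟩⟩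
  simp only [(h i).2, abs_div, abs_mul, abs_neg_one_pow]
  simp

theorem exists_abs_le (hr : RecursiveRat r) : ∃ B : ι → ℕ, Computable B ∧ ∀ i, |r i| ≤ B i := by
  obtain ⟨_, p, q, -, hp, -, h⟩ := hr
  refine ⟨p, hp, fun i => ?_⟩
  rw [(h i).2, abs_div, abs_mul, abs_neg_one_pow, one_mul, Nat.abs_cast, Nat.abs_cast]
  exact div_le_self (Nat.cast_nonneg _) (Nat.one_le_cast.2 (Nat.one_le_iff_ne_zero.2 (h i).1))

theorem exists_sub_div (hr : RecursiveRat r) : ∃ a b q : ι → ℕ,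
    Computable a ∧ Computable b ∧ Computable q ∧ ∀ i, q i ≠ 0 ∧ r i = ((a i : ℚ) - b i) / q i := by
  obtain ⟨s, p, q, hs, hp, hq, h⟩ := hr
  have hsign (n : ℕ) : (-1 : ℚ) ^ n = 1 - 2 * (n % 2 : ℕ) := by
    rcases Nat.even_or_odd n with hn | hn
    · simp [hn.neg_one_pow, Nat.even_iff.1 hn]
    · norm_num [hn.neg_one_pow, Nat.odd_iff.1 hn]
  refine ⟨p, fun i => 2 * (s i % 2) * p i, q, hp,
    computable_mul (computable_mul (.const 2) (computable_mod hs (.const 2))) hp, hq,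
    fun i => ⟨(h i).1, ?_⟩⟩
  rw [(h i).2, hsign]
  push_cast
  ring

theorem of_sub_div {a b q : ι → ℕ} (ha : Computable a) (hb : Computable b) (hq : Computable q)
    (h : ∀ i, q i ≠ 0 ∧ r i = ((a i : ℚ) - b i) / q i) : RecursiveRat r := by
  refine ⟨fun i => if a i < b i then 1 else 0, fun i => (a i - b i) + (b i - a i), q,
    computable_ite (computablePred_lt ha hb) (.const 1) (.const 0),
    computable_add (computable_sub ha hb) (computable_sub hb ha), hq, fun i => ⟨(h i).1, ?_⟩⟩
  beta_reduce
  rw [(h i).2]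
  congr 1
  rcases lt_or_ge (a i) (b i) with hab | hab
  · rw [if_pos hab, Nat.sub_eq_zero_of_le hab.le]
    push_cast [hab.le]
    ring
  · rw [if_neg hab.not_gt, Nat.sub_eq_zero_of_le hab]
    push_cast [hab]
    ring

theorem neg (hr : RecursiveRat r) : RecursiveRat fun i => -r i := by
  obtain ⟨a, b, q, ha, hb, hq, h⟩ := hr.exists_sub_div
  exact of_sub_div hb ha hq fun i => ⟨(h i).1, by rw [(h i).2, ← neg_div, neg_sub]⟩

theorem add (hr : RecursiveRat r) (hr' : RecursiveRat r') : RecursiveRat fun i => r i + r' i := by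
  obtain ⟨a, b, q, ha, hb, hq, h⟩ := hr.exists_sub_div
  obtain ⟨a', b', q', ha', hb', hq', h'⟩ := hr'.exists_sub_div
  refine of_sub_div (computable_add (computable_mul ha hq') (computable_mul hq ha'))
    (computable_add (computable_mul hb hq') (computable_mul hq hb')) (computable_mul hq hq')
    fun i => ⟨mul_ne_zero (h i).1 (h' i).1, ?_⟩
  rw [(h i).2, (h' i).2, div_add_div _ _ (Nat.cast_ne_zero.2 (h i).1)
    (Nat.cast_ne_zero.2 (h' i).1)]
  push_cast
  ring

theorem sum_range {r : ι × ℕ → ℚ} (hr : RecursiveRat r) {n : ι → ℕ} (hn : Computable n) :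
    RecursiveRat fun i => ∑ j ∈ Finset.range (n i), r (i, j) := by
  obtain ⟨a, b, q, ha, hb, hq, h⟩ := hr.exists_sub_div
  let Q (i : ι) : ℕ := ∏ j ∈ Finset.range (n i), q (i, j)
  have hQ : Computable Q := computable_prod_range Primrec.nat_mul.to_comp hq hn
  have hnum {c : ι × ℕ → ℕ} (hc : Computable c) :
      Computable fun i => ∑ j ∈ Finset.range (n i), c (i, j) * (Q i / q (i, j)) :=
    computable_sum_range Primrec.nat_add.to_comp
      (computable_mul hc (computable_div (hQ.comp .fst) hq)) hn
  have hQ0 (i : ι) : Q i ≠ 0 := Finset.prod_ne_zero_iff.2 fun j _ => (h (i, j)).1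
  refine of_sub_div (hnum ha) (hnum hb) hQ fun i => ⟨hQ0 i, ?_⟩
  push_cast
  rw [← Finset.sum_sub_distrib, Finset.sum_div]
  refine Finset.sum_congr rfl fun j hj => ?_
  have hq0 : (q (i, j) : ℚ) ≠ 0 := Nat.cast_ne_zero.2 (h (i, j)).1
  have hQ0' : (Q i : ℚ) ≠ 0 := Nat.cast_ne_zero.2 (hQ0 i)
  have hdvd : q (i, j) ∣ Q i := Finset.dvd_prod_of_mem _ hj
  rw [(h (i, j)).2, Nat.cast_div hdvd hq0]
  field_simp

theorem computablePred_pos (hr : RecursiveRat r) : ComputablePred fun i => 0 < r i := by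
  obtain ⟨a, b, q, ha, hb, -, h⟩ := hr.exists_sub_div
  refine (computablePred_lt hb ha).of_eq fun i => ?_
  have hq : (0 : ℚ) < q i := Nat.cast_pos.2 (Nat.pos_of_ne_zero (h i).1)
  rw [(h i).2, div_pos_iff_of_pos_right hq, sub_pos, Nat.cast_lt]

end RecursiveRat

theorem natCast_mul_half_pow_add_lt (B k : ℕ) : (B : ℝ) * (1 / 2) ^ (k + B) < (1 / 2) ^ k := by
  have hB : (B : ℝ) < 2 ^ B := mod_cast B.lt_two_pow_self
  rw [pow_add, mul_left_comm, one_div_pow 2 B, mul_one_div]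
  exact mul_lt_of_lt_one_right (by positivity) ((div_lt_one (by positivity)).2 hB)

namespace ComputableRealSeq

variable {ι κ : Type} [Primcodable ι] [Primcodable κ] {x y : ι → ℝ}

theorem comp (hx : ComputableRealSeq x) {e : κ → ι} (he : Computable e) :
    ComputableRealSeq fun j => x (e j) := by
  obtain ⟨r, hr, h⟩ := hx
  exact ⟨_, hr.comp ((he.comp .fst).pair .snd), fun j k => h (e j) k⟩

theorem ratCast {r : ι → ℚ} (hr : RecursiveRat r) : ComputableRealSeq fun i => (r i : ℝ) :=
  ⟨fun p => r p.1, hr.comp .fst, fun i k => by simp⟩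

theorem natCast {f : ι → ℕ} (hf : Computable f) : ComputableRealSeq fun i => (f i : ℝ) := by
  simpa using ratCast (.natCast hf)

theorem inv_natCast {f : ι → ℕ} (hf : Computable f) (h : ∀ i, f i ≠ 0) :
    ComputableRealSeq fun i => (f i : ℝ)⁻¹ := by
  simpa using ratCast (.inv_natCast hf h)

theorem half_pow {e : ι → ℕ} (he : Computable e) :
    ComputableRealSeq fun i => (1 / 2 : ℝ) ^ e i := by
  simpa using ratCast (.half_pow he)

theorem exists_approx_bound (hx : ComputableRealSeq x) :
    ∃ (r : ι × ℕ → ℚ) (B : ι → ℕ), RecursiveRat r ∧ Computable B ∧ ∀ i, |x i| ≤ B i ∧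
      ∀ k, |(r (i, k) : ℝ)| ≤ B i ∧ |(r (i, k) : ℝ) - x i| ≤ (1 / 2) ^ k := by
  obtain ⟨r, hr, h⟩ := hx
  obtain ⟨B, hB, hrB⟩ := (hr.comp (Computable.id.pair (.const 0))).exists_abs_le
  refine ⟨r, fun i => B i + 2, hr, computable_add hB (.const 2), fun i => ?_⟩
  have h0 : |(r (i, 0) : ℝ)| ≤ B i := mod_cast hrB i
  have hx : |x i| ≤ B i + 1 := by
    linarith [abs_sub_abs_le_abs_sub (x i) (r (i, 0)), abs_sub_comm (x i) (r (i, 0)),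
      (h i 0).trans_eq (pow_zero _)]
  push_cast
  refine ⟨by linarith, fun k => ⟨?_, h i k⟩⟩
  have hk : (1 / 2 : ℝ) ^ k ≤ 1 := pow_le_one₀ (by norm_num) (by norm_num)
  linarith [abs_sub_abs_le_abs_sub (r (i, k) : ℝ) (x i), h i k]

theorem exists_abs_le (hx : ComputableRealSeq x) :
    ∃ B : ι → ℕ, Computable B ∧ ∀ i, |x i| ≤ B i :=
  let ⟨_, B, _, hB, h⟩ := hx.exists_approx_bound
  ⟨B, hB, fun i => (h i).1⟩

theorem of_effectiveLimit {y : ι × ℕ → ℝ} (hy : ComputableRealSeq y) {B : ι → ℕ}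
    (hB : Computable B) (h : ∀ i k, |y (i, k) - x i| ≤ B i * (1 / 2) ^ k) :
    ComputableRealSeq x := by
  obtain ⟨r, hr, hry⟩ := hy
  have hB' : Computable fun p : ι × ℕ => B p.1 := hB.comp .fst
  refine ⟨fun p => r ((p.1, p.2 + 1 + B p.1), p.2 + 1), hr.comp ((Computable.fst.pair
    (computable_add (Computable.succ.comp .snd) hB')).pair (Computable.succ.comp .snd)),
    fun i k => ?_⟩
  calc |(r ((i, k + 1 + B i), k + 1) : ℝ) - x i|
      ≤ |(r ((i, k + 1 + B i), k + 1) : ℝ) - y (i, k + 1 + B i)| + |y (i, k + 1 + B i) - x i| :=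
        abs_sub_le _ _ _
    _ ≤ (1 / 2) ^ (k + 1) + B i * (1 / 2) ^ (k + 1 + B i) := add_le_add (hry _ _) (h _ _)
    _ ≤ (1 / 2) ^ (k + 1) + (1 / 2) ^ (k + 1) := by
        gcongr; exact (natCast_mul_half_pow_add_lt (B i) (k + 1)).le
    _ = (1 / 2) ^ k := by ring

theorem neg (hx : ComputableRealSeq x) : ComputableRealSeq fun i => -x i := by
  obtain ⟨r, hr, h⟩ := hx
  refine ⟨_, hr.neg, fun i k => ?_⟩
  rw [Rat.cast_neg, neg_sub_neg, abs_sub_comm]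
  exact h i k

theorem add (hx : ComputableRealSeq x) (hy : ComputableRealSeq y) :
    ComputableRealSeq fun i => x i + y i := by
  obtain ⟨r, hr, hrx⟩ := hx
  obtain ⟨s, hs, hsy⟩ := hy
  refine of_effectiveLimit (ratCast (hr.add hs)) (.const 2) fun i k => ?_
  push_cast
  rw [add_sub_add_comm, two_mul]
  exact (abs_add_le _ _).trans (add_le_add (hrx i k) (hsy i k))

theorem sub (hx : ComputableRealSeq x) (hy : ComputableRealSeq y) :
    ComputableRealSeq fun i => x i - y i := by
  simpa only [sub_eq_add_neg] using hx.add hy.neg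

theorem mul (hx : ComputableRealSeq x) (hy : ComputableRealSeq y) :
    ComputableRealSeq fun i => x i * y i := by
  obtain ⟨r, A, hr, hA, hrx⟩ := hx.exists_approx_bound
  obtain ⟨s, B, hs, hB, hsy⟩ := hy.exists_approx_bound
  refine of_effectiveLimit (ratCast (hr.mul hs)) (computable_add hA hB) fun i k => ?_
  have hr' := ((hrx i).2 k).1
  calc |((r (i, k) * s (i, k) : ℚ) : ℝ) - x i * y i|
      = |r (i, k) * (s (i, k) - y i) + (r (i, k) - x i) * y i| := by push_cast; congr 1; ring
    _ ≤ |(r (i, k) : ℝ)| * |s (i, k) - y i| + |r (i, k) - x i| * |y i| := by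
        simpa only [abs_mul] using
          abs_add_le (r (i, k) * (s (i, k) - y i) : ℝ) ((r (i, k) - x i) * y i)
    _ ≤ A i * (1 / 2) ^ k + (1 / 2) ^ k * B i := by
        gcongr
        exacts [((hsy i).2 k).2, ((hrx i).2 k).2, (hsy i).1]
    _ = (A i + B i : ℕ) * (1 / 2) ^ k := by push_cast; ring

theorem abs (hx : ComputableRealSeq x) : ComputableRealSeq fun i => |x i| := by
  obtain ⟨r, hr, h⟩ := hx
  refine ⟨_, hr.abs, fun i k => ?_⟩
  rw [Rat.cast_abs]
  exact (abs_abs_sub_abs_le _ _).trans (h i k)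

theorem max (hx : ComputableRealSeq x) (hy : ComputableRealSeq y) :
    ComputableRealSeq fun i => max (x i) (y i) := by
  have h := ((hx.add hy).add (hy.sub hx).abs).mul (inv_natCast (.const 2) fun _ => two_ne_zero)
  convert h using 2 with i
  rcases le_total (x i) (y i) with hle | hle
  · rw [max_eq_right hle, abs_of_nonneg (sub_nonneg.2 hle)]
    push_cast; ring
  · rw [max_eq_left hle, abs_of_nonpos (sub_nonpos.2 hle)]
    push_cast; ring

theorem pow (hx : ComputableRealSeq x) {e : ι → ℕ} (he : Computable e) :
    ComputableRealSeq fun i => x i ^ e i := by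
  obtain ⟨r, B, hr, hB, h⟩ := hx.exists_approx_bound
  refine of_effectiveLimit (ratCast (hr.pow (he.comp .fst)))
    (computable_mul he (computable_pow hB (computable_sub he (.const 1)))) fun i k => ?_
  obtain ⟨hxB, hri⟩ := h i
  calc |((r (i, k) ^ e i : ℚ) : ℝ) - x i ^ e i|
      ≤ |r (i, k) - x i| * e i * Max.max |(r (i, k) : ℝ)| |x i| ^ (e i - 1) := by
        push_cast; exact abs_pow_sub_pow_le _ _ _
    _ ≤ (1 / 2) ^ k * e i * B i ^ (e i - 1) := by
        gcongr
        exacts [(hri k).2, max_le (hri k).1 hxB]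
    _ = (e i * B i ^ (e i - 1) : ℕ) * (1 / 2) ^ k := by push_cast; ring

theorem sum_range {x : ι × ℕ → ℝ} (hx : ComputableRealSeq x) {n : ι → ℕ} (hn : Computable n) :
    ComputableRealSeq fun i => ∑ j ∈ Finset.range (n i), x (i, j) := by
  obtain ⟨r, hr, h⟩ := hx
  have hr' : RecursiveRat fun p : (ι × ℕ) × ℕ => r ((p.1.1, p.2), p.1.2) :=
    hr.comp (((Computable.fst.comp .fst).pair .snd).pair (Computable.snd.comp .fst))
  refine of_effectiveLimit (ratCast (hr'.sum_range (hn.comp .fst))) hn fun i k => ?_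
  push_cast
  rw [← Finset.sum_sub_distrib]
  refine (Finset.abs_sum_le_sum_abs _ _).trans ((Finset.sum_le_card_nsmul _ _ _
    fun j _ => h (i, j) k).trans_eq ?_)
  rw [Finset.card_range, nsmul_eq_mul]

theorem exists_computable_pos {x : ι × ℕ → ℝ} (hx : ComputableRealSeq x)
    (hpos : ∀ i, ∃ n, 0 < x (i, n)) : ∃ N : ι → ℕ, Computable N ∧ ∀ i, 0 < x (i, N i) := by
  obtain ⟨r, hr, h⟩ := hx
  -- One search runs over the index `n` and the precision `k`, coded as a single number `l`.
  let s (p : ι × ℕ) : ℚ := r ((p.1, p.2.unpair.1), p.2.unpair.2) - (1 / 2) ^ p.2.unpair.2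
  have hs : RecursiveRat s := by
    have hfst : Computable fun p : ι × ℕ => p.2.unpair.1 := computable_unpair_fst .snd
    have hsnd : Computable fun p : ι × ℕ => p.2.unpair.2 := computable_unpair_snd .snd
    simpa only [s, sub_eq_add_neg] using
      (hr.comp ((Computable.fst.pair hfst).pair hsnd)).add (RecursiveRat.half_pow hsnd).neg
  obtain ⟨l, hl, hsl⟩ := exists_computable_of_computablePred hs.computablePred_pos fun i => by
    obtain ⟨n, hn⟩ := hpos i
    obtain ⟨k, hk⟩ := exists_pow_lt_of_lt_one (half_pos hn) one_half_lt_one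
    refine ⟨Nat.pair n k, ?_⟩
    have hrk := abs_le.1 (h (i, n) k)
    simp only [s, Nat.unpair_pair]
    rify
    linarith
  refine ⟨fun i => (l i).unpair.1, computable_unpair_fst hl, fun i => ?_⟩
  have hi : ((1 / 2) ^ (l i).unpair.2 : ℝ) < r ((i, (l i).unpair.1), (l i).unpair.2) := by
    have := sub_pos.1 (hsl i)
    rify at this
    exact this
  linarith [abs_le.1 (h (i, (l i).unpair.1) (l i).unpair.2)]

end ComputableRealSeq

/-- The sum of the first `n` terms of the power series of `cos` (for `e = 0`) or `sin` (for
`e = 1`) at the origin, through which both are shown to be computable. -/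
noncomputable def trigPartialSum (e n : ℕ) (y : ℝ) : ℝ :=
  ∑ j ∈ Finset.range n, (-1) ^ j * (y ^ (2 * j + e) * ((2 * j + e).factorial : ℝ)⁻¹)

theorem sum_range_two_mul_exp_series (n : ℕ) (y : ℝ) :
    ∑ m ∈ Finset.range (2 * n), ((y : ℂ) * Complex.I) ^ m / (m.factorial : ℂ) =
      trigPartialSum 0 n y + trigPartialSum 1 n y * Complex.I := by
  induction n with
  | zero => simp [trigPartialSum]
  | succ n ih =>
    rw [mul_add_one, Finset.sum_range_succ, Finset.sum_range_succ, ih]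
    simp only [trigPartialSum, Finset.sum_range_succ]
    push_cast
    rw [mul_pow, mul_pow, pow_succ Complex.I, pow_mul Complex.I, Complex.I_sq]
    simp only [add_zero]
    ring

theorem two_pow_mul_pow_two_mul_le_factorial {B n : ℕ} (h : 2 * B ^ 2 ≤ n + 1) :
    2 ^ n * B ^ (2 * n) ≤ (2 * n).factorial :=
  calc 2 ^ n * B ^ (2 * n) = (2 * B ^ 2) ^ n := by rw [mul_pow, pow_mul]
    _ ≤ (n + 1) ^ n := Nat.pow_le_pow_left h n
    _ ≤ n.factorial * (n + 1) ^ n := Nat.le_mul_of_pos_left _ n.factorial_pos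
    _ ≤ (2 * n).factorial := two_mul n ▸ Nat.factorial_mul_pow_le_factorial

theorem norm_exp_sub_trigPartialSum_le {B n : ℕ} (hn : 2 * B ^ 2 ≤ n) {y : ℝ} (hy : |y| ≤ B) :
    ‖Complex.exp (y * Complex.I) - (trigPartialSum 0 n y + trigPartialSum 1 n y * Complex.I)‖ ≤
      2 * (1 / 2) ^ n := by
  have hnorm : ‖(y : ℂ) * Complex.I‖ = |y| := by simp
  have hBn : (B : ℝ) ≤ n := mod_cast (by nlinarith : B ≤ n)
  have hratio : ‖(y : ℂ) * Complex.I‖ / (2 * n).succ ≤ 1 / 2 := by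
    rw [hnorm, div_le_iff₀ (by positivity)]
    push_cast
    linarith
  have hfact : (2 : ℝ) ^ n * B ^ (2 * n) ≤ (2 * n).factorial :=
    mod_cast two_pow_mul_pow_two_mul_le_factorial (hn.trans n.le_succ)
  rw [← sum_range_two_mul_exp_series]
  calc _ ≤ |y| ^ (2 * n) / (2 * n).factorial * 2 := hnorm ▸ Complex.exp_bound' hratio
    _ ≤ B ^ (2 * n) / (2 * n).factorial * 2 := by gcongr
    _ ≤ 1 / 2 ^ n * 2 := by
        refine mul_le_mul_of_nonneg_right ?_ zero_le_two
        rwa [div_le_div_iff₀ (by positivity) (by positivity), one_mul, mul_comm]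
    _ = 2 * (1 / 2) ^ n := by rw [mul_comm, one_div_pow]

theorem abs_trigPartialSum_zero_sub_cos_le {B n : ℕ} (hn : 2 * B ^ 2 ≤ n) {y : ℝ}
    (hy : |y| ≤ B) : |trigPartialSum 0 n y - Real.cos y| ≤ 2 * (1 / 2) ^ n := by
  rw [abs_sub_comm]
  simpa [Complex.exp_ofReal_mul_I_re] using
    (Complex.abs_re_le_norm _).trans (norm_exp_sub_trigPartialSum_le hn hy)

theorem abs_trigPartialSum_one_sub_sin_le {B n : ℕ} (hn : 2 * B ^ 2 ≤ n) {y : ℝ}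
    (hy : |y| ≤ B) : |trigPartialSum 1 n y - Real.sin y| ≤ 2 * (1 / 2) ^ n := by
  rw [abs_sub_comm]
  simpa [Complex.exp_ofReal_mul_I_im] using
    (Complex.abs_im_le_norm _).trans (norm_exp_sub_trigPartialSum_le hn hy)

namespace ComputableRealSeq

variable {ι : Type} [Primcodable ι] {x : ι → ℝ}

theorem trigPartialSum (hx : ComputableRealSeq x) (e : ℕ) {n : ι → ℕ} (hn : Computable n) :
    ComputableRealSeq fun i => trigPartialSum e (n i) (x i) := by
  have hdeg : Computable fun p : ι × ℕ => 2 * p.2 + e :=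
    computable_add (computable_mul (.const 2) .snd) (.const e)
  have hsign : ComputableRealSeq fun p : ι × ℕ => (-1 : ℝ) ^ p.2 := by
    simpa using (natCast (.const 1)).neg.pow .snd
  exact (hsign.mul (((hx.comp .fst).pow hdeg).mul
    (inv_natCast (computable_factorial hdeg) fun _ => Nat.factorial_ne_zero _))).sum_range hn

theorem of_trigPartialSum {e : ℕ} {g : ℝ → ℝ}
    (hg : ∀ {B n : ℕ}, 2 * B ^ 2 ≤ n → ∀ {y : ℝ}, |y| ≤ B →
      |CompProb.trigPartialSum e n y - g y| ≤ 2 * (1 / 2) ^ n)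
    (hx : ComputableRealSeq x) : ComputableRealSeq fun i => g (x i) := by
  obtain ⟨B, hB, hxB⟩ := hx.exists_abs_le
  have hdeg : Computable fun p : ι × ℕ => 2 * B p.1 ^ 2 + p.2 :=
    computable_add (computable_mul (.const 2) (computable_pow (hB.comp .fst) (.const 2))) .snd
  refine of_effectiveLimit ((hx.comp .fst).trigPartialSum e hdeg) (.const 2) fun i k => ?_
  refine (hg (Nat.le_add_right _ _) (hxB i)).trans ?_
  exact mul_le_mul_of_nonneg_left
    (pow_le_pow_of_le_one (by norm_num) (by norm_num) (Nat.le_add_left _ _)) zero_le_two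

theorem cos (hx : ComputableRealSeq x) : ComputableRealSeq fun i => Real.cos (x i) :=
  hx.of_trigPartialSum abs_trigPartialSum_zero_sub_cos_le

theorem sin (hx : ComputableRealSeq x) : ComputableRealSeq fun i => Real.sin (x i) :=
  hx.of_trigPartialSum abs_trigPartialSum_one_sub_sin_le

end ComputableRealSeq

theorem ComputableComplexSeq.of_re_im {ι : Type} [Primcodable ι] {z : ι → ℂ}
    (hre : ComputableRealSeq fun i => (z i).re) (him : ComputableRealSeq fun i => (z i).im) :
    ComputableComplexSeq z := by
  obtain ⟨r, hr, hre⟩ := hre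
  obtain ⟨s, hs, him⟩ := him
  have hsucc : Computable fun p : ι × ℕ => (p.1, p.2 + 1) :=
    Computable.fst.pair (Computable.succ.comp .snd)
  refine ⟨_, _, hr.comp hsucc, hs.comp hsucc, fun i k => ?_⟩
  calc ‖((r (i, k + 1) : ℂ) + (s (i, k + 1) : ℂ) * Complex.I) - z i‖
      ≤ |(r (i, k + 1) : ℝ) - (z i).re| + |(s (i, k + 1) : ℝ) - (z i).im| := by
        simpa using Complex.norm_le_abs_re_add_abs_im
          (((r (i, k + 1) : ℂ) + (s (i, k + 1) : ℂ) * Complex.I) - z i)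
    _ ≤ (1 / 2) ^ (k + 1) + (1 / 2) ^ (k + 1) := add_le_add (hre _ _) (him _ _)
    _ = (1 / 2) ^ k := by ring

namespace ComputableFunSeq

variable {f : ℕ → ℝ → ℝ}

theorem of_lipschitzWith
    (hf : ∀ x : ℕ → ℝ, ComputableRealSeq x → ComputableRealSeq fun i : ℕ × ℕ => f i.1 (x i.2))
    {K : ℕ → ℕ} (hK : Computable K) (hlip : ∀ n, LipschitzWith (K n) (f n)) :
    ComputableFunSeq f := by
  refine ⟨hf, fun p => p.2.2 + K p.1, computable_add (Computable.snd.comp .snd) (hK.comp .fst),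
    fun n L k x y _ _ hxy => ?_⟩
  calc |f n x - f n y| ≤ K n * |x - y| := (hlip n).dist_le_mul x y
    _ ≤ K n * (1 / 2) ^ (k + K n) := by gcongr
    _ < (1 / 2) ^ k := natCast_mul_half_pow_add_lt _ _

theorem comp (hf : ComputableFunSeq f) {e : ℕ → ℕ} (he : Computable e) :
    ComputableFunSeq fun n => f (e n) := by
  obtain ⟨hseq, α, hα, hfα⟩ := hf
  exact ⟨fun x hx => (hseq x hx).comp ((he.comp .fst).pair .snd), fun p => α (e p.1, p.2),
    hα.comp ((he.comp .fst).pair .snd), fun n => hfα (e n)⟩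

theorem mul_of_abs_le (hf : ComputableFunSeq f) {g : ℕ → ℝ → ℝ} (hg : ComputableFunSeq g)
    {A B : ℕ → ℕ} (hA : Computable A) (hB : Computable B) (hfA : ∀ n x, |f n x| ≤ A n)
    (hgB : ∀ n x, |g n x| ≤ B n) : ComputableFunSeq fun n x => f n x * g n x := by
  obtain ⟨hfseq, α, hα, hfα⟩ := hf
  obtain ⟨hgseq, β, hβ, hgβ⟩ := hg
  have hprec {C : ℕ → ℕ} (hC : Computable C) :
      Computable fun p : ℕ × ℕ × ℕ => (p.1, p.2.1, p.2.2 + 1 + C p.1) :=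
    Computable.fst.pair ((Computable.fst.comp .snd).pair
      (computable_add (Computable.succ.comp (Computable.snd.comp .snd)) (hC.comp .fst)))
  refine ⟨fun x hx => (hfseq x hx).mul (hgseq x hx),
    fun p => α (p.1, p.2.1, p.2.2 + 1 + B p.1) + β (p.1, p.2.1, p.2.2 + 1 + A p.1),
    computable_add (hα.comp (hprec hB)) (hβ.comp (hprec hA)), fun n L k x y hx hy hxy => ?_⟩
  have hfxy : |f n x - f n y| < (1 / 2) ^ (k + 1 + B n) := hfα n L _ x y hx hy <| hxy.trans_le <|
    pow_le_pow_of_le_one (by norm_num) (by norm_num) (Nat.le_add_right _ _)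
  have hgxy : |g n x - g n y| < (1 / 2) ^ (k + 1 + A n) := hgβ n L _ x y hx hy <| hxy.trans_le <|
    pow_le_pow_of_le_one (by norm_num) (by norm_num) (Nat.le_add_left _ _)
  calc |f n x * g n x - f n y * g n y|
      = |f n x * (g n x - g n y) + g n y * (f n x - f n y)| := by congr 1; ring
    _ ≤ |f n x| * |g n x - g n y| + |g n y| * |f n x - f n y| := by
        simpa only [abs_mul] using abs_add_le (f n x * (g n x - g n y)) (g n y * (f n x - f n y))
    _ ≤ A n * (1 / 2) ^ (k + 1 + A n) + B n * (1 / 2) ^ (k + 1 + B n) := by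
        gcongr
        exacts [hfA n x, hgB n y]
    _ < (1 / 2) ^ (k + 1) + (1 / 2) ^ (k + 1) :=
        add_lt_add (natCast_mul_half_pow_add_lt _ _) (natCast_mul_half_pow_add_lt _ _)
    _ = (1 / 2) ^ k := by ring

theorem continuous (hf : ComputableFunSeq f) (n : ℕ) : Continuous (f n) := by
  obtain ⟨α, -, hα⟩ := hf.effectivelyContinuous
  refine Metric.continuous_iff.2 fun x ε hε => ?_
  obtain ⟨k, hk⟩ := exists_pow_lt_of_lt_one hε one_half_lt_one
  obtain ⟨L, hL⟩ := exists_nat_ge (|x| + 1)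
  refine ⟨min 1 ((1 / 2) ^ α (n, L, k)), by positivity, fun y hy => ?_⟩
  rw [Real.dist_eq, lt_min_iff] at hy
  exact (hα n L k y x (by linarith [abs_sub_abs_le_abs_sub y x]) (by linarith) hy.2).trans hk

theorem comp_mul_of_lipschitzWith {t : ℕ → ℝ} (ht : ComputableRealSeq t) {g : ℝ → ℝ}
    (hg : ∀ y : ℕ × ℕ → ℝ, ComputableRealSeq y → ComputableRealSeq fun i => g (y i))
    {K : ℕ} (hlip : LipschitzWith K g) : ComputableFunSeq fun n x => g (t n * x) := by
  obtain ⟨B, hB, htB⟩ := ht.exists_abs_le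
  refine .of_lipschitzWith (fun x hx => hg _ ((ht.comp .fst).mul (hx.comp .snd)))
    (computable_mul (.const K) hB) fun n => ?_
  have hmul : LipschitzWith (B n) fun x => t n * x := .of_dist_le_mul fun x y => by
    rw [Real.dist_eq, Real.dist_eq, ← mul_sub, abs_mul]
    exact mul_le_mul_of_nonneg_right (htB n) (abs_nonneg _)
  exact mod_cast hlip.comp hmul

end ComputableFunSeq

theorem norm_integral_sub_integral_smul_le {Ω E : Type*} [MeasurableSpace Ω]
    [NormedAddCommGroup E] [NormedSpace ℝ E] {ν : Measure Ω} [IsFiniteMeasure ν] {w : Ω → ℝ}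
    (hw : AEStronglyMeasurable w ν) (hw0 : ∀ x, 0 ≤ w x) (hw1 : ∀ x, w x ≤ 1) {f : Ω → E}
    (hf : AEStronglyMeasurable f ν) {C : ℝ} (hC : ∀ x, ‖f x‖ ≤ C) :
    ‖∫ x, f x ∂ν - ∫ x, w x • f x ∂ν‖ ≤ C * (ν.real Set.univ - ∫ x, w x ∂ν) := by
  have hwnorm (x : Ω) : ‖w x‖ ≤ 1 := (Real.norm_of_nonneg (hw0 x)).trans_le (hw1 x)
  have hwint : Integrable w ν := .of_bound hw 1 (.of_forall hwnorm)
  have hfint : Integrable f ν := .of_bound hf C (.of_forall hC)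
  have hwf : Integrable (fun x => w x • f x) ν := hfint.bdd_smul 1 hw (.of_forall hwnorm)
  have hpt (x : Ω) : ‖f x - w x • f x‖ ≤ C * (1 - w x) :=
    calc ‖f x - w x • f x‖ = ‖(1 - w x) • f x‖ := by rw [sub_smul, one_smul]
      _ = ‖f x‖ * (1 - w x) := by
          rw [norm_smul, Real.norm_of_nonneg (sub_nonneg.2 (hw1 x)), mul_comm]
      _ ≤ C * (1 - w x) := mul_le_mul_of_nonneg_right (hC x) (sub_nonneg.2 (hw1 x))
  calc ‖∫ x, f x ∂ν - ∫ x, w x • f x ∂ν‖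
      = ‖∫ x, (f x - w x • f x) ∂ν‖ := by rw [integral_sub hfint hwf]
    _ ≤ ∫ x, C * (1 - w x) ∂ν := norm_integral_le_of_norm_le
        (((integrable_const 1).sub hwint).const_mul C) (.of_forall hpt)
    _ = C * (ν.real Set.univ - ∫ x, w x ∂ν) := by
        rw [integral_const_mul, integral_sub (integrable_const 1) hwint]; simp

/-- The tent function of height `1` supported on `[-(N + 1), N + 1]`, used as a computable cutoff;
the shift by `1` avoids a degenerate tent at `N = 0`. -/
noncomputable def tent (N : ℕ) (x : ℝ) : ℝ := max (1 - |x| * ((N + 1 : ℕ) : ℝ)⁻¹) 0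

section Tent

variable {N : ℕ} {x : ℝ}

theorem tent_nonneg : 0 ≤ tent N x := le_max_right _ _

theorem tent_le_one : tent N x ≤ 1 := max_le (sub_le_self _ (by positivity)) zero_le_one

theorem abs_tent_le_one : |tent N x| ≤ 1 := (abs_of_nonneg tent_nonneg).trans_le tent_le_one

theorem tent_eq_zero (h : ((N + 1 : ℕ) : ℝ) ≤ |x|) : tent N x = 0 := by
  refine max_eq_right (sub_nonpos.2 ?_)
  rwa [← div_eq_mul_inv, one_le_div (by positivity)]

theorem lipschitzWith_tent : LipschitzWith 1 (tent N) := .of_dist_le_mul fun x y => by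
  have hN : ((N + 1 : ℕ) : ℝ)⁻¹ ≤ 1 := inv_le_one_of_one_le₀ (mod_cast N.succ_pos)
  calc |tent N x - tent N y|
      ≤ |(1 - |x| * ((N + 1 : ℕ) : ℝ)⁻¹) - (1 - |y| * ((N + 1 : ℕ) : ℝ)⁻¹)| :=
        abs_max_sub_max_le_abs _ _ _
    _ = |(|y| - |x|)| * ((N + 1 : ℕ) : ℝ)⁻¹ := by
        rw [sub_sub_sub_cancel_left, ← sub_mul, abs_mul, abs_inv, Nat.abs_cast]
    _ ≤ |y - x| * 1 := mul_le_mul (abs_abs_sub_abs_le _ _) hN (by positivity) (abs_nonneg _)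
    _ = (1 : NNReal) * |x - y| := by rw [mul_one, abs_sub_comm, NNReal.coe_one, one_mul]

theorem tendsto_tent (x : ℝ) : Filter.Tendsto (fun N => tent N x) Filter.atTop (nhds 1) := by
  have hinv : Filter.Tendsto (fun N : ℕ => ((N + 1 : ℕ) : ℝ)⁻¹) Filter.atTop (nhds 0) :=
    tendsto_inv_atTop_zero.comp
      (tendsto_natCast_atTop_atTop.comp (Filter.tendsto_add_atTop_nat 1))
  simpa [tent] using ((hinv.const_mul |x|).const_sub 1).max (tendsto_const_nhds (x := (0 : ℝ)))

theorem computableFunSeq_tent : ComputableFunSeq tent := by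
  refine .of_lipschitzWith (fun x hx => ?_) (.const 1) fun N => mod_cast lipschitzWith_tent
  have hN : ComputableRealSeq fun i : ℕ × ℕ => ((i.1 + 1 : ℕ) : ℝ)⁻¹ :=
    .inv_natCast (Computable.succ.comp .fst) fun i => i.1.succ_ne_zero
  simpa [tent] using ((ComputableRealSeq.natCast (.const 1)).sub ((hx.comp .snd).abs.mul hN)).max
    (.natCast (.const 0))

theorem computableCompactSupport_tent : ComputableCompactSupport tent :=
  ⟨computableFunSeq_tent, fun N => N + 1, Computable.succ, fun _ _ => tent_eq_zero⟩

theorem ComputableFunSeq.computableCompactSupport_tent_mul {f : ℕ → ℝ → ℝ}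
    (hf : ComputableFunSeq f) {B : ℕ → ℕ} (hB : Computable B) (hfB : ∀ n x, |f n x| ≤ B n) :
    ComputableCompactSupport fun l x => tent l.unpair.2 x * f l.unpair.1 x := by
  have hfst : Computable fun l : ℕ => l.unpair.1 := computable_unpair_fst .id
  have hsnd : Computable fun l : ℕ => l.unpair.2 := computable_unpair_snd .id
  refine ⟨(computableFunSeq_tent.comp hsnd).mul_of_abs_le (hf.comp hfst) (.const 1)
    (hB.comp hfst) (fun _ _ => mod_cast abs_tent_le_one) fun l => hfB l.unpair.1,
    fun l => l.unpair.2 + 1, Computable.succ.comp hsnd, fun l x hx => ?_⟩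
  beta_reduce
  rw [tent_eq_zero hx, zero_mul]

variable (ν : Measure ℝ) [IsFiniteMeasure ν]

theorem integrable_tent : Integrable (tent N) ν :=
  .of_bound lipschitzWith_tent.continuous.aestronglyMeasurable 1
    (.of_forall fun _ => abs_tent_le_one)

theorem tendsto_integral_tent :
    Filter.Tendsto (fun N => ∫ x, tent N x ∂ν) Filter.atTop (nhds (ν.real Set.univ)) := by
  simpa using tendsto_integral_of_dominated_convergence (F := tent) (f := fun _ => 1) (fun _ => 1)
    (fun _ => (integrable_tent ν).aestronglyMeasurable) (integrable_const 1)
    (fun _ => .of_forall fun _ => abs_tent_le_one) (.of_forall tendsto_tent)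

end Tent

namespace ComputableDistSeq

variable {μ : ℕ → Measure ℝ} [∀ m, IsFiniteMeasure (μ m)]

theorem exists_computable_tent (hμ : ComputableDistSeq μ)
    (hmass : ComputableRealSeq fun m => (μ m).real Set.univ) :
    ∃ N : ℕ × ℕ → ℕ, Computable N ∧
      ∀ m k, (μ m).real Set.univ - ∫ x, tent (N (m, k)) x ∂(μ m) < (1 / 2) ^ k := by
  have htent : ComputableRealSeq fun p : (ℕ × ℕ) × ℕ => ∫ x, tent p.2 x ∂(μ p.1.1) :=
    (hμ tent computableCompactSupport_tent).comp ((Computable.fst.comp .fst).pair .snd)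
  have hslack : ComputableRealSeq fun p : (ℕ × ℕ) × ℕ =>
      (1 / 2) ^ p.1.2 - ((μ p.1.1).real Set.univ - ∫ x, tent p.2 x ∂(μ p.1.1)) :=
    (ComputableRealSeq.half_pow (Computable.snd.comp .fst)).sub
      ((hmass.comp (Computable.fst.comp .fst)).sub htent)
  obtain ⟨N, hN, hpos⟩ := hslack.exists_computable_pos fun p => by
    have hlim := (tendsto_integral_tent (μ p.1)).const_sub ((μ p.1).real Set.univ)
    rw [sub_self] at hlim
    exact (hlim.eventually_lt_const (by positivity : (0 : ℝ) < (1 / 2) ^ p.2)).exists.imp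
      fun N hN => sub_pos.2 hN
  exact ⟨N, hN, fun m k => sub_pos.1 (hpos (m, k))⟩

theorem computableRealSeq_integral (hμ : ComputableDistSeq μ)
    (hmass : ComputableRealSeq fun m => (μ m).real Set.univ) {f : ℕ → ℝ → ℝ}
    (hf : ComputableFunSeq f) {B : ℕ → ℕ} (hB : Computable B) (hfB : ∀ n x, |f n x| ≤ B n) :
    ComputableRealSeq fun i : ℕ × ℕ => ∫ x, f i.2 x ∂(μ i.1) := by
  obtain ⟨N, hN, htail⟩ := hμ.exists_computable_tent hmass
  have hcode : Computable fun p : (ℕ × ℕ) × ℕ => (p.1.1, Nat.pair p.1.2 (N (p.1.1, p.2))) :=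
    (Computable.fst.comp .fst).pair <| computable_natPair (Computable.snd.comp .fst)
      (hN.comp ((Computable.fst.comp .fst).pair .snd))
  have hcut : ComputableRealSeq fun p : (ℕ × ℕ) × ℕ =>
      ∫ x, tent (N (p.1.1, p.2)) x * f p.1.2 x ∂(μ p.1.1) := by
    simpa only [Nat.unpair_pair] using
      (hμ _ (hf.computableCompactSupport_tent_mul hB hfB)).comp hcode
  refine .of_effectiveLimit hcut (hB.comp .snd) fun ⟨m, n⟩ k => ?_
  calc |∫ x, tent (N (m, k)) x * f n x ∂(μ m) - ∫ x, f n x ∂(μ m)|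
      ≤ B n * ((μ m).real Set.univ - ∫ x, tent (N (m, k)) x ∂(μ m)) := by
        rw [abs_sub_comm]
        exact norm_integral_sub_integral_smul_le (integrable_tent _).aestronglyMeasurable
          (fun _ => tent_nonneg) (fun _ => tent_le_one) (hf.continuous n).aestronglyMeasurable
          (hfB n)
    _ ≤ B n * (1 / 2) ^ k := mul_le_mul_of_nonneg_left (htail m k).le (Nat.cast_nonneg _)

end ComputableDistSeq

section CharFun

variable (t u : ℝ)

theorem norm_exp_mul_I_sub_exp_mul_I_le :
    ‖Complex.exp (t * Complex.I) - Complex.exp (u * Complex.I)‖ ≤ |t - u| := by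
  have hfactor : Complex.exp (t * Complex.I) - Complex.exp (u * Complex.I) =
      Complex.exp (u * Complex.I) * (Complex.exp (Complex.I * (t - u : ℝ)) - 1) := by
    rw [mul_sub_one, ← Complex.exp_add]
    congr 2
    push_cast
    ring
  rw [hfactor, norm_mul, Complex.norm_exp_ofReal_mul_I, one_mul]
  exact Real.norm_exp_I_mul_ofReal_sub_one_le

theorem charFun_eq_integral_exp_ofReal_mul_I (ν : Measure ℝ) :
    charFun ν t = ∫ x, Complex.exp ((t * x : ℝ) * Complex.I) ∂ν := by
  simp only [charFun_apply_real, Complex.ofReal_mul]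

variable {ν : Measure ℝ} [IsFiniteMeasure ν]

theorem integrable_exp_mul_I : Integrable (fun x : ℝ => Complex.exp ((t * x : ℝ) * Complex.I)) ν :=
  .of_bound (by fun_prop) 1 (.of_forall fun x => (Complex.norm_exp_ofReal_mul_I _).le)

theorem re_charFun : (charFun ν t).re = ∫ x, Real.cos (t * x) ∂ν := by
  simp only [charFun_eq_integral_exp_ofReal_mul_I, ← Complex.exp_ofReal_mul_I_re]
  exact (integral_re (integrable_exp_mul_I t)).symm

theorem im_charFun : (charFun ν t).im = ∫ x, Real.sin (t * x) ∂ν := by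
  simp only [charFun_eq_integral_exp_ofReal_mul_I, ← Complex.exp_ofReal_mul_I_im]
  exact (integral_im (integrable_exp_mul_I t)).symm

theorem norm_charFun_sub_charFun_le (N : ℕ) :
    ‖charFun ν t - charFun ν u‖ ≤
      (N + 1 : ℕ) * |t - u| * ν.real Set.univ + 2 * (ν.real Set.univ - ∫ x, tent N x ∂ν) := by
  let d (x : ℝ) : ℂ := Complex.exp ((t * x : ℝ) * Complex.I) - Complex.exp ((u * x : ℝ) * Complex.I)
  have hd : ‖∫ x, d x ∂ν - ∫ x, tent N x • d x ∂ν‖ ≤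
      2 * (ν.real Set.univ - ∫ x, tent N x ∂ν) :=
    norm_integral_sub_integral_smul_le (integrable_tent ν).aestronglyMeasurable
      (fun _ => tent_nonneg) (fun _ => tent_le_one) (by fun_prop) fun x => by
        refine (norm_sub_le _ _).trans_eq ?_
        rw [Complex.norm_exp_ofReal_mul_I, Complex.norm_exp_ofReal_mul_I, one_add_one_eq_two]
  have hpt (x : ℝ) : ‖tent N x • d x‖ ≤ (N + 1 : ℕ) * |t - u| := by
    rw [norm_smul, Real.norm_of_nonneg tent_nonneg]
    rcases le_total ((N + 1 : ℕ) : ℝ) |x| with hx | hx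
    · rw [tent_eq_zero hx, zero_mul]
      positivity
    · calc tent N x * ‖d x‖ ≤ 1 * |t * x - u * x| := mul_le_mul tent_le_one
            (norm_exp_mul_I_sub_exp_mul_I_le _ _) (norm_nonneg _) zero_le_one
        _ = |x| * |t - u| := by rw [one_mul, ← sub_mul, abs_mul, mul_comm]
        _ ≤ (N + 1 : ℕ) * |t - u| := mul_le_mul_of_nonneg_right hx (abs_nonneg _)
  have hcut := norm_integral_le_of_norm_le_const (μ := ν) (.of_forall hpt)
  rw [charFun_eq_integral_exp_ofReal_mul_I, charFun_eq_integral_exp_ofReal_mul_I,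
    ← integral_sub (integrable_exp_mul_I t) (integrable_exp_mul_I u)]
  calc ‖∫ x, d x ∂ν‖
      ≤ ‖∫ x, tent N x • d x ∂ν‖ + ‖∫ x, d x ∂ν - ∫ x, tent N x • d x ∂ν‖ :=
        norm_le_norm_add_norm_sub' _ _
    _ ≤ _ := add_le_add hcut hd

end CharFun

namespace ComputableDistSeq

variable {μ : ℕ → Measure ℝ} [∀ m, IsFiniteMeasure (μ m)]

theorem computableComplexSeq_charFun (hμ : ComputableDistSeq μ)
    (hmass : ComputableRealSeq fun m => (μ m).real Set.univ) {t : ℕ → ℝ}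
    (ht : ComputableRealSeq t) :
    ComputableComplexSeq fun i : ℕ × ℕ => charFun (μ i.1) (t i.2) := by
  refine .of_re_im ?_ ?_
  · simp only [re_charFun]
    exact hμ.computableRealSeq_integral hmass (.comp_mul_of_lipschitzWith (K := 1) ht
      (fun _ hy => hy.cos) (mod_cast Real.lipschitzWith_cos)) (.const 1)
      fun n x => mod_cast Real.abs_cos_le_one (t n * x)
  · simp only [im_charFun]
    exact hμ.computableRealSeq_integral hmass (.comp_mul_of_lipschitzWith (K := 1) ht
      (fun _ hy => hy.sin) (mod_cast Real.lipschitzWith_sin)) (.const 1)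
      fun n x => mod_cast Real.abs_sin_le_one (t n * x)

theorem exists_modulus_charFun (hμ : ComputableDistSeq μ)
    (hmass : ComputableRealSeq fun m => (μ m).real Set.univ) :
    ∃ α : ℕ × ℕ → ℕ, Computable α ∧ ∀ (m k : ℕ) (t u : ℝ), |t - u| < (1 / 2) ^ α (m, k) →
      ‖charFun (μ m) t - charFun (μ m) u‖ < (1 / 2) ^ k := by
  obtain ⟨N, hN, htail⟩ := hμ.exists_computable_tent hmass
  obtain ⟨B, hB, hmassB⟩ := hmass.exists_abs_le
  have hN2 : Computable fun p : ℕ × ℕ => N (p.1, p.2 + 2) :=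
    hN.comp (Computable.fst.pair (computable_add .snd (.const 2)))
  refine ⟨fun p => p.2 + 1 + (N (p.1, p.2 + 2) + 1) * B p.1, computable_add
    (Computable.succ.comp .snd) (computable_mul (Computable.succ.comp hN2) (hB.comp .fst)),
    fun m k t u htu => ?_⟩
  set n := N (m, k + 2)
  calc ‖charFun (μ m) t - charFun (μ m) u‖
      ≤ (n + 1 : ℕ) * |t - u| * (μ m).real Set.univ +
          2 * ((μ m).real Set.univ - ∫ x, tent n x ∂(μ m)) := norm_charFun_sub_charFun_le t u n
    _ ≤ ((n + 1) * B m : ℕ) * (1 / 2) ^ (k + 1 + (n + 1) * B m) + 2 * (1 / 2) ^ (k + 2) := by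
        rw [mul_right_comm, Nat.cast_mul]
        gcongr
        exacts [(le_abs_self _).trans (hmassB m), (htail m (k + 2)).le]
    _ < (1 / 2) ^ (k + 1) + 2 * (1 / 2) ^ (k + 2) :=
        add_lt_add_left (natCast_mul_half_pow_add_lt _ _) _
    _ = (1 / 2) ^ k := by ring

end ComputableDistSeq

end CompProb

theorem theorem4p1_general (μ : ℕ → Measure ℝ) [∀ m, IsFiniteMeasure (μ m)]
    (hμ : CompProb.ComputableDistSeq μ)
    (hmass : CompProb.ComputableRealSeq fun m => (μ m).real Set.univ) :
    CompProb.UniformlyComputableFunSeq fun m => charFun (μ m) :=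
  ⟨fun _ ht => hμ.computableComplexSeq_charFun hmass ht, hμ.exists_modulus_charFun hmass⟩

theorem theorem4p1 (μ : ℕ → MeasureTheory.Measure ℝ)
    [∀ m, MeasureTheory.IsProbabilityMeasure (μ m)]
    (hμ : CompProb.ComputableDistSeq μ) :
    CompProb.UniformlyComputableFunSeq fun m => MeasureTheory.charFun (μ m) :=
  theorem4p1_general μ hμ (by simpa using CompProb.ComputableRealSeq.natCast (.const 1))
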